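/- Let $\Gamma \rightrightarrows M$ be a Lie groupoid with source $\alpha$ and target $\beta$, where $gh$ is defined if and only if $\alpha(g)=\beta(h)$, and let $A\to M$ be its Lie algebroid, with fibres $A_x=\ker(T_{1_x}\alpha)\subset T_{1_x}\Gamma$ and anchor $\rho=T\beta|_A$. Let $T\Gamma\rightrightarrows TM$ be the tangent groupoid, whose structure maps are the tangent maps of those of $\Gamma$; write $X\cdot Y$ for its product. Let $T^*\Gamma\rightrightarrows A^*$ be the cotangent groupoid: for $\xi\in T_g^*\Gamma$ its source in $A^*_{\alpha(g)}$ is $a\mapsto \xi\big(g\cdot(a-\rho(a))\big)$, its target in $A^*_{\beta(g)}$ is $a\mapsto\xi(a\cdot g)$ (here $g\cdot{}$ and ${}\cdot g$ are the tangent maps of left and right translation by $g$, and $TM$ is regarded as the tangent bundle of the submanifold of units), and if the source of $\xi\in T_g^*\Gamma$ is the target of $\eta\in T_h^*\Gamma$, the product $\xi\cdot\eta\in T_{gh}^*\Gamma$ is the element such that $(\xi\cdot\eta)(X\cdot Y)=\xi(X)+\eta(Y)$ for all composable $X\in T_g\Gamma$, $Y\in T_h\Gamma$. Let $\omega$ be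 a smooth $2$-form on $\Gamma$, and let $\omega^\flat:T\Gamma\to T^*\Gamma$, $\omega^\flat(X)=-i_X\omega=\omega(\cdot,X)$. The following properties are equivalent. 1. There is a vector-bundle morphism $\underline\omega:TM\to A^*$ (over the identity of $M$) such that $\omega^\flat$ is a morphism of Lie groupoids from $T\Gamma\rightrightarrows TM$ to $T^*\Gamma\rightrightarrows A^*$ over $\underline\omega$. 2. For every pair $(X,Y)$ of composable elements of $T\Gamma$, the elements $\omega^\flat(X)$ and $\omega^\flat(Y)$ of $T^*\Gamma$ are composable and $\omega^\flat(X\cdot Y)=\omega^\flat(X)\cdot\omega^\flat(Y)$. 3. The function $(X_1,X_2)\mapsto\omega(X_1,X_2)$ is a morphism of Lie groupoids from the direct sum groupoid $T\Gamma\oplus T\Gamma\rightrightarrows TM\oplus TM$ to the additive group $\mathbb R$, considered as a groupoid over a point. 4. For all $g,h\in\Gamma$ and all $X_1,X_2\in T_g\Gamma$ and $Y_1,Y_2\in T_h\Gamma$ such that $(X_1,Y_1)$ and $(X_2,Y_2)$ are composable in $T\Gamma$, $$\omega(X_1\cdot Y_1,\,X_2\cdot Y_2)=\omega(X_1,X_2)+\omega(Y_1,Y_2).$$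 -/

import Mathlib

open scoped Manifold ContDiff Bundle
open Set Bundle

noncomputable section

universe u

namespace KernelBundle

variable {E : Type u} [NormedAddCommGroup E] [NormedSpace ℝ E]
  {EM : Type*} [NormedAddCommGroup EM] [NormedSpace ℝ EM]
  {F : Type*} [NormedAddCommGroup F] [NormedSpace ℝ F]
  {Γ : Type*} [TopologicalSpace Γ] [ChartedSpace E Γ]
  {M : Type*} [TopologicalSpace M] [ChartedSpace EM M]
  {f : Γ → M} {p : Γ}

/-- In a chart in which the submersion `f` is a linear projection `E ≃ EM × F → EM`, the
`F`-component of a tangent vector. -/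
def coord (h : Manifold.IsSubmersionAtOfComplement F 𝓘(ℝ, E) 𝓘(ℝ, EM) ∞ f p) (q : Γ) :
    TangentSpace 𝓘(ℝ, E) q →L[ℝ] F :=
  (ContinuousLinearMap.snd ℝ EM F).comp
    ((h.equiv : E →L[ℝ] EM × F).comp (mfderiv 𝓘(ℝ, E) 𝓘(ℝ, E) h.domChart q))

/-- The tangent vector at `q` whose image in the chart has components `0` and `w`. -/
def symm (h : Manifold.IsSubmersionAtOfComplement F 𝓘(ℝ, E) 𝓘(ℝ, EM) ∞ f p) (q : Γ) :
    F →L[ℝ] TangentSpace 𝓘(ℝ, E) q :=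
  (mfderiv 𝓘(ℝ, E) 𝓘(ℝ, E) h.domChart q).inverse.comp
    ((h.equiv.symm : EM × F →L[ℝ] E).comp (ContinuousLinearMap.inr ℝ EM F))

theorem mdiff {e : OpenPartialHomeomorph Γ E}
    (he : e ∈ IsManifold.maximalAtlas 𝓘(ℝ, E) ∞ Γ) {q : Γ} (hq : q ∈ e.source) :
    MDifferentiableAt 𝓘(ℝ, E) 𝓘(ℝ, E) e q :=
  (contMDiffAt_of_mem_maximalAtlas he hq).mdifferentiableAt (by simp)

theorem mdiff_symm {e : OpenPartialHomeomorph Γ E}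
    (he : e ∈ IsManifold.maximalAtlas 𝓘(ℝ, E) ∞ Γ) {q : E} (hq : q ∈ e.target) :
    MDifferentiableAt 𝓘(ℝ, E) 𝓘(ℝ, E) e.symm q :=
  (contMDiffAt_symm_of_mem_maximalAtlas he hq).mdifferentiableAt (by simp)

theorem isInvertible {e : OpenPartialHomeomorph Γ E}
    (he : e ∈ IsManifold.maximalAtlas 𝓘(ℝ, E) ∞ Γ) {q : Γ} (hq : q ∈ e.source) :
    (mfderiv 𝓘(ℝ, E) 𝓘(ℝ, E) e q).IsInvertible := by
  have hd : e.MDifferentiable 𝓘(ℝ, E) 𝓘(ℝ, E) :=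
    ⟨fun q hq => (mdiff he hq).mdifferentiableWithinAt,
      fun q hq => (mdiff_symm he hq).mdifferentiableWithinAt⟩
  exact ⟨hd.mfderiv hq, rfl⟩

/-- In the charts of a submersion, its derivative is the first component. -/
theorem mfderiv_codChart (h : Manifold.IsSubmersionAtOfComplement F 𝓘(ℝ, E) 𝓘(ℝ, EM) ∞ f p)
    {q : Γ} (hq : q ∈ h.domChart.source) (v : TangentSpace 𝓘(ℝ, E) q) :
    mfderiv 𝓘(ℝ, EM) 𝓘(ℝ, EM) h.codChart (f q) (mfderiv 𝓘(ℝ, E) 𝓘(ℝ, EM) f q v) =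
      (h.equiv (mfderiv 𝓘(ℝ, E) 𝓘(ℝ, E) h.domChart q v)).1 := by
  have hf : MDifferentiableAt 𝓘(ℝ, E) 𝓘(ℝ, EM) f q :=
    (h.contMDiffOn.contMDiffAt (h.domChart.open_source.mem_nhds hq)).mdifferentiableAt (by simp)
  have hψ := mdiff h.codChart_mem_maximalAtlas (h.source_subset_preimage_source hq)
  have hφ := mdiff h.domChart_mem_maximalAtlas hq
  let L : E →L[ℝ] EM := (ContinuousLinearMap.fst ℝ EM F).comp (h.equiv : E →L[ℝ] EM × F)
  have hL : MDifferentiableAt 𝓘(ℝ, E) 𝓘(ℝ, EM) L (h.domChart q) :=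
    L.differentiableAt.mdifferentiableAt
  have hev : (h.codChart ∘ f) =ᶠ[nhds q] (L ∘ h.domChart) := by
    filter_upwards [h.domChart.open_source.mem_nhds hq] with y hy
    have := h.writtenInCharts ((h.domChart.extend 𝓘(ℝ, E)).map_source
      ((h.domChart.extend_source (I := 𝓘(ℝ, E))).symm ▸ hy))
    simpa [h.domChart.left_inv hy, L] using this
  have h1 := mfderiv_comp q hψ hf
  have h2 := mfderiv_comp q hL hφ
  rw [hev.mfderiv_eq, h2] at h1
  have h3 := congrArg (fun T => T v) h1
  have h4 : mfderiv 𝓘(ℝ, E) 𝓘(ℝ, EM) L (h.domChart q) = L := by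
    rw [mfderiv_eq_fderiv]; exact L.fderiv
  rw [h4] at h3
  exact h3.symm

/-- A tangent vector at a point of the chart lies in the kernel iff its `EM`-component is zero. -/
theorem mem_ker_iff (h : Manifold.IsSubmersionAtOfComplement F 𝓘(ℝ, E) 𝓘(ℝ, EM) ∞ f p)
    {q : Γ} (hq : q ∈ h.domChart.source) (v : TangentSpace 𝓘(ℝ, E) q) :
    mfderiv 𝓘(ℝ, E) 𝓘(ℝ, EM) f q v = 0 ↔
      (h.equiv (mfderiv 𝓘(ℝ, E) 𝓘(ℝ, E) h.domChart q v)).1 = 0 := by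
  rw [← mfderiv_codChart h hq]
  have hi := isInvertible h.codChart_mem_maximalAtlas (h.source_subset_preimage_source hq)
  constructor
  · intro h0; rw [h0]; exact map_zero _
  · intro h0
    have := hi.inverse_apply_self (mfderiv 𝓘(ℝ, E) 𝓘(ℝ, EM) f q v)
    rw [← this]
    erw [h0, map_zero]

theorem equiv_mfderiv_symm (h : Manifold.IsSubmersionAtOfComplement F 𝓘(ℝ, E) 𝓘(ℝ, EM) ∞ f p)
    {q : Γ} (hq : q ∈ h.domChart.source) (w : F) :
    h.equiv (mfderiv 𝓘(ℝ, E) 𝓘(ℝ, E) h.domChart q (symm h q w)) = ((0, w) : EM × F) := by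
  have := (isInvertible h.domChart_mem_maximalAtlas hq).self_apply_inverse
    (h.equiv.symm ((0, w) : EM × F))
  exact (congrArg h.equiv this).trans (h.equiv.apply_symm_apply _)

theorem coord_symm (h : Manifold.IsSubmersionAtOfComplement F 𝓘(ℝ, E) 𝓘(ℝ, EM) ∞ f p)
    {q : Γ} (hq : q ∈ h.domChart.source) (w : F) : coord h q (symm h q w) = w :=
  congrArg Prod.snd (equiv_mfderiv_symm h hq w)

theorem symm_mem (h : Manifold.IsSubmersionAtOfComplement F 𝓘(ℝ, E) 𝓘(ℝ, EM) ∞ f p)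
    {q : Γ} (hq : q ∈ h.domChart.source) (w : F) :
    mfderiv 𝓘(ℝ, E) 𝓘(ℝ, EM) f q (symm h q w) = 0 := by
  rw [mem_ker_iff h hq]
  exact congrArg Prod.fst (equiv_mfderiv_symm h hq w)

theorem symm_coord (h : Manifold.IsSubmersionAtOfComplement F 𝓘(ℝ, E) 𝓘(ℝ, EM) ∞ f p)
    {q : Γ} (hq : q ∈ h.domChart.source) (v : TangentSpace 𝓘(ℝ, E) q)
    (hv : mfderiv 𝓘(ℝ, E) 𝓘(ℝ, EM) f q v = 0) : symm h q (coord h q v) = v := by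
  rw [mem_ker_iff h hq] at hv
  have h1 := (isInvertible h.domChart_mem_maximalAtlas hq).inverse_apply_self v
  have h2 : ((0, coord h q v) : EM × F) =
      h.equiv (mfderiv 𝓘(ℝ, E) 𝓘(ℝ, E) h.domChart q v) := Prod.ext hv.symm rfl
  have h3 : h.equiv.symm ((0, coord h q v) : EM × F) =
      mfderiv 𝓘(ℝ, E) 𝓘(ℝ, E) h.domChart q v := by
    rw [h2]; exact h.equiv.symm_apply_apply _
  exact (congrArg (mfderiv 𝓘(ℝ, E) 𝓘(ℝ, E) h.domChart q).inverse h3).trans h1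

/-- The change of coordinates in the kernel between two charts adapted to the submersion. -/
theorem coord_symm_eq {p' : Γ}
    (h : Manifold.IsSubmersionAtOfComplement F 𝓘(ℝ, E) 𝓘(ℝ, EM) ∞ f p)
    (h' : Manifold.IsSubmersionAtOfComplement F 𝓘(ℝ, E) 𝓘(ℝ, EM) ∞ f p')
    {q : Γ} (hq : q ∈ h.domChart.source) (hq' : q ∈ h'.domChart.source) (w : F) :
    coord h' q (symm h q w) =
      (h'.equiv (fderiv ℝ (h'.domChart ∘ h.domChart.symm) (h.domChart q)
        (h.equiv.symm ((0, w) : EM × F)))).2 := by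
  have hs := mdiff_symm h.domChart_mem_maximalAtlas (h.domChart.map_source hq)
  have hd := mdiff h.domChart_mem_maximalAtlas hq
  have hd' : MDifferentiableAt 𝓘(ℝ, E) 𝓘(ℝ, E) h'.domChart
      (h.domChart.symm (h.domChart q)) := by
    rw [h.domChart.left_inv hq]; exact mdiff h'.domChart_mem_maximalAtlas hq'
  have hc := hd'.comp (h.domChart q) hs
  have hev : (h'.domChart : Γ → E) =ᶠ[nhds q]
      ((h'.domChart ∘ h.domChart.symm) ∘ h.domChart) := by
    filter_upwards [h.domChart.open_source.mem_nhds hq] with y hy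
    simp [h.domChart.left_inv hy]
  have h1 := mfderiv_comp q hc hd
  rw [← hev.mfderiv_eq, mfderiv_eq_fderiv] at h1
  have h2 := congrArg (fun T => (h'.equiv (T (symm h q w))).2) h1
  have h3 := (isInvertible h.domChart_mem_maximalAtlas hq).self_apply_inverse
    (h.equiv.symm ((0, w) : EM × F))
  exact h2.trans (congrArg (fun z => (h'.equiv
    (fderiv ℝ (h'.domChart ∘ h.domChart.symm) (h.domChart q) z)).2) h3)

variable {ε : M → Γ}

variable (f ε) in
/-- The kernels of the derivative of `f`, along `ε`. -/
abbrev Fiber (x : M) : Type _ :=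
  (mfderiv 𝓘(ℝ, E) 𝓘(ℝ, EM) f (ε x)).ker

open Classical in
/-- The local trivialization of the bundle of kernels by the chart around `ε x`. -/
def triv (hε : Continuous ε)
    {x : M} (h : Manifold.IsSubmersionAtOfComplement F 𝓘(ℝ, E) 𝓘(ℝ, EM) ∞ f (ε x)) :
    Pretrivialization F (π F (Fiber (E := E) (EM := EM) f ε)) where
  toFun v := (v.1, coord h (ε v.1) v.2.1)
  invFun z := ⟨z.1, if hz : ε z.1 ∈ h.domChart.source then
    ⟨symm h (ε z.1) z.2, symm_mem h hz z.2⟩ else 0⟩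
  source := π F (Fiber (E := E) (EM := EM) f ε) ⁻¹' (ε ⁻¹' h.domChart.source)
  target := (ε ⁻¹' h.domChart.source) ×ˢ univ
  map_source' v hv := ⟨hv, mem_univ _⟩
  map_target' z hz := hz.1
  left_inv' v hv := by
    have hv' : ε v.1 ∈ h.domChart.source := hv
    obtain ⟨y, v, hvk⟩ := v
    simp only [hv', dite_true, TotalSpace.mk.injEq, heq_eq_eq, true_and]
    exact Subtype.ext (symm_coord h hv' v hvk)
  right_inv' z hz := by
    have hz' : ε z.1 ∈ h.domChart.source := hz.1
    simp only [hz', dite_true]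
    exact Prod.ext rfl (coord_symm h hz' z.2)
  open_target := (h.domChart.open_source.preimage hε).prod isOpen_univ
  baseSet := ε ⁻¹' h.domChart.source
  open_baseSet := h.domChart.open_source.preimage hε
  source_eq := rfl
  target_eq := rfl
  proj_toFun _ _ := rfl

theorem triv_symm (hε : Continuous ε)
    {x : M} (h : Manifold.IsSubmersionAtOfComplement F 𝓘(ℝ, E) 𝓘(ℝ, EM) ∞ f (ε x))
    {b : M} (hb : ε b ∈ h.domChart.source) (w : F) :
    (triv hε h).symm b w = ⟨symm h (ε b) w, symm_mem h hb w⟩ := by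
  have hb' : b ∈ (triv hε h).baseSet := hb
  rw [Pretrivialization.symm_apply _ hb']
  have : ((triv hε h).toPartialEquiv.symm (b, w)) =
    ⟨b, ⟨symm h (ε b) w, symm_mem h hb w⟩⟩ := by
      change TotalSpace.mk b _ = _
      simp only [hb, dite_true]
  apply eq_of_heq
  refine (cast_heq _ _).trans ?_
  rw [this]

/-- The transition functions between the trivializations `triv`. -/
def trans {x x' : M} (h : Manifold.IsSubmersionAtOfComplement F 𝓘(ℝ, E) 𝓘(ℝ, EM) ∞ f (ε x))
    (h' : Manifold.IsSubmersionAtOfComplement F 𝓘(ℝ, E) 𝓘(ℝ, EM) ∞ f (ε x')) (b : M) :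
    F →L[ℝ] F :=
  ((ContinuousLinearMap.snd ℝ EM F).comp (h'.equiv : E →L[ℝ] EM × F)).comp
    ((fderiv ℝ (h'.domChart ∘ h.domChart.symm) (h.domChart (ε b))).comp
      ((h.equiv.symm : EM × F →L[ℝ] E).comp (ContinuousLinearMap.inr ℝ EM F)))

theorem trans_apply (hε : Continuous ε) {x x' : M}
    (h : Manifold.IsSubmersionAtOfComplement F 𝓘(ℝ, E) 𝓘(ℝ, EM) ∞ f (ε x))
    (h' : Manifold.IsSubmersionAtOfComplement F 𝓘(ℝ, E) 𝓘(ℝ, EM) ∞ f (ε x')) {b : M}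
    (hb : b ∈ (triv hε h).baseSet ∩ (triv hε h').baseSet) (w : F) :
    trans h h' b w = (triv hε h' ⟨b, (triv hε h).symm b w⟩).2 := by
  rw [triv_symm hε h hb.1]
  exact (coord_symm_eq h h' hb.1 hb.2 w).symm

theorem contMDiffOn_trans (hε : ContMDiff 𝓘(ℝ, EM) 𝓘(ℝ, E) ∞ ε) {x x' : M}
    (h : Manifold.IsSubmersionAtOfComplement F 𝓘(ℝ, E) 𝓘(ℝ, EM) ∞ f (ε x))
    (h' : Manifold.IsSubmersionAtOfComplement F 𝓘(ℝ, E) 𝓘(ℝ, EM) ∞ f (ε x')) :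
    ContMDiffOn 𝓘(ℝ, EM) 𝓘(ℝ, F →L[ℝ] F) ∞ (trans h h')
      ((triv hε.continuous h).baseSet ∩ (triv hε.continuous h').baseSet) := by
  have h1 : ContDiffOn ℝ ∞ (h'.domChart ∘ h.domChart.symm)
      (h.domChart.symm.trans h'.domChart).source := by
    rw [← contMDiffOn_iff_contDiffOn]
    refine (contMDiffOn_of_mem_maximalAtlas h'.domChart_mem_maximalAtlas).comp
      ((contMDiffOn_symm_of_mem_maximalAtlas h.domChart_mem_maximalAtlas).mono
        (fun y hy => hy.1)) (fun y hy => hy.2)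
  have h2 := h1.fderiv_of_isOpen (m := ∞) (h.domChart.symm.trans h'.domChart).open_source (by simp)
  have h3 : ContMDiffOn 𝓘(ℝ, EM) 𝓘(ℝ, E) ∞ (h.domChart ∘ ε)
      ((triv hε.continuous h).baseSet ∩ (triv hε.continuous h').baseSet) :=
    (contMDiffOn_of_mem_maximalAtlas h.domChart_mem_maximalAtlas).comp hε.contMDiffOn
      (fun y hy => hy.1)
  have h4 := (contMDiffOn_iff_contDiffOn.mpr h2).comp h3 (fun y hy => by
    refine ⟨h.domChart.map_source hy.1, ?_⟩
    change h.domChart.symm (h.domChart (ε y)) ∈ h'.domChart.source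
    rw [h.domChart.left_inv hy.1]; exact hy.2)
  have h5 : ContDiff ℝ ∞ (fun T : E →L[ℝ] E =>
      ((ContinuousLinearMap.snd ℝ EM F).comp (h'.equiv : E →L[ℝ] EM × F)).comp
        (T.comp ((h.equiv.symm : EM × F →L[ℝ] E).comp (ContinuousLinearMap.inr ℝ EM F)))) := by
    fun_prop
  exact h5.contMDiff.comp_contMDiffOn h4

/-- The vector bundle of kernels of a submersion along a smooth map. -/
def prebundle (hε : ContMDiff 𝓘(ℝ, EM) 𝓘(ℝ, E) ∞ ε)
    (h : ∀ x, Manifold.IsSubmersionAtOfComplement F 𝓘(ℝ, E) 𝓘(ℝ, EM) ∞ f (ε x)) :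
    VectorPrebundle ℝ F (Fiber (E := E) (EM := EM) f ε) where
  pretrivializationAtlas := range fun x => triv hε.continuous (h x)
  pretrivialization_linear' := by
    rintro _ ⟨x, rfl⟩
    exact ⟨fun b _ => ⟨fun v w => (coord (h x) (ε b)).map_add v.1 w.1,
      fun c v => (coord (h x) (ε b)).map_smul c v.1⟩⟩
  pretrivializationAt x := triv hε.continuous (h x)
  mem_base_pretrivializationAt x := (h x).mem_domChart_source
  pretrivialization_mem_atlas x := ⟨x, rfl⟩
  exists_coordChange := by
    rintro _ ⟨x, rfl⟩ _ ⟨x', rfl⟩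
    exact ⟨trans (h x) (h x'), (contMDiffOn_trans hε (h x) (h x')).continuousOn,
      fun b hb w => trans_apply hε.continuous (h x) (h x') hb w⟩
  totalSpaceMk_isInducing b := by
    have hb := (h b).mem_domChart_source
    let g : M × F → Fiber (E := E) (EM := EM) f ε b := fun z =>
      ⟨symm (h b) (ε b) z.2, symm_mem (h b) hb z.2⟩
    have hg : Continuous g :=
      ((symm (h b) (ε b)).continuous.comp continuous_snd).subtype_mk _
    have hf : Continuous (triv hε.continuous (h b) ∘ TotalSpace.mk b) :=
      continuous_const.prodMk ((coord (h b) (ε b)).continuous.comp continuous_subtype_val)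
    have hl : Function.LeftInverse g (triv hε.continuous (h b) ∘ TotalSpace.mk b) :=
      fun v => Subtype.ext (symm_coord (h b) hb v.1 v.2)
    exact (hl.isEmbedding hg hf).isInducing

theorem prebundle_isContMDiff (hε : ContMDiff 𝓘(ℝ, EM) 𝓘(ℝ, E) ∞ ε)
    (h : ∀ x, Manifold.IsSubmersionAtOfComplement F 𝓘(ℝ, E) 𝓘(ℝ, EM) ∞ f (ε x)) :
    (prebundle hε h).IsContMDiff 𝓘(ℝ, EM) ∞ where
  exists_contMDiffCoordChange := by
    rintro _ ⟨x, rfl⟩ _ ⟨x', rfl⟩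
    exact ⟨trans (h x) (h x'), contMDiffOn_trans hε (h x) (h x'),
      fun b hb w => trans_apply hε.continuous (h x) (h x') hb w⟩

end KernelBundle

variable (E : Type u) [NormedAddCommGroup E] [NormedSpace ℝ E]
  (EM : Type*) [NormedAddCommGroup EM] [NormedSpace ℝ EM]
  (Γ : Type*) [TopologicalSpace Γ] [ChartedSpace E Γ]
  (M : Type*) [TopologicalSpace M] [ChartedSpace EM M]

/-- A Lie groupoid `Γ ⇉ M`; `E` and `EM` are the model spaces of the manifolds `Γ` and `M`.
The product `mul g h` is defined when `src g = tgt h`; its values on other pairs are irrelevant.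
It is smooth on the submanifold of composable pairs. The submersions `src` and `tgt` are surjective
by `src_unit` and `tgt_unit`. -/
structure LieGroupoid where
  src : Γ → M
  tgt : Γ → M
  unit : M → Γ
  inv : Γ → Γ
  mul : Γ → Γ → Γ
  src_unit : ∀ x, src (unit x) = x
  tgt_unit : ∀ x, tgt (unit x) = x
  src_mul : ∀ g h, src g = tgt h → src (mul g h) = src h
  tgt_mul : ∀ g h, src g = tgt h → tgt (mul g h) = tgt g
  mul_assoc : ∀ g h k, src g = tgt h → src h = tgt k → mul (mul g h) k = mul g (mul h k)
  mul_unit : ∀ g, mul g (unit (src g)) = g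
  unit_mul : ∀ g, mul (unit (tgt g)) g = g
  src_inv : ∀ g, src (inv g) = tgt g
  tgt_inv : ∀ g, tgt (inv g) = src g
  mul_inv : ∀ g, mul g (inv g) = unit (tgt g)
  inv_mul : ∀ g, mul (inv g) g = unit (src g)
  submersion_src : Manifold.IsSubmersion 𝓘(ℝ, E) 𝓘(ℝ, EM) ∞ src
  submersion_tgt : Manifold.IsSubmersion 𝓘(ℝ, E) 𝓘(ℝ, EM) ∞ tgt
  contMDiff_unit : ContMDiff 𝓘(ℝ, EM) 𝓘(ℝ, E) ∞ unit
  contMDiff_inv : ContMDiff 𝓘(ℝ, E) 𝓘(ℝ, E) ∞ inv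
  contMDiffOn_mul : ContMDiffOn (𝓘(ℝ, E).prod 𝓘(ℝ, E)) 𝓘(ℝ, E) ∞
    (fun z : Γ × Γ => mul z.1 z.2) {z | src z.1 = tgt z.2}

/-- A smooth 2-form on `Γ`: a smooth section, with alternating values, of the bundle of bilinear
forms on the tangent spaces. -/
structure TwoForm [IsManifold 𝓘(ℝ, E) ∞ Γ] where
  toFun : ∀ g : Γ, TangentSpace 𝓘(ℝ, E) g →L[ℝ] TangentSpace 𝓘(ℝ, E) g →L[ℝ] ℝ
  alternating : ∀ (g : Γ) (X : TangentSpace 𝓘(ℝ, E) g), toFun g X X = 0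
  contMDiff : ContMDiff 𝓘(ℝ, E) (𝓘(ℝ, E).prod 𝓘(ℝ, E →L[ℝ] E →L[ℝ] ℝ)) ∞
    (fun g => TotalSpace.mk' (E →L[ℝ] E →L[ℝ] ℝ) g (toFun g))

variable {E EM Γ M}

/-- The identification of the tangent spaces at two equal points. -/
def tangentCast {p q : Γ} (h : p = q) : TangentSpace 𝓘(ℝ, E) p →L[ℝ] TangentSpace 𝓘(ℝ, E) q :=
  h ▸ ContinuousLinearMap.id ℝ (TangentSpace 𝓘(ℝ, E) p)

theorem mk_tangentCast {p q : Γ} (h : p = q) (v : TangentSpace 𝓘(ℝ, E) p) :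
    (⟨q, tangentCast h v⟩ : TangentBundle 𝓘(ℝ, E) Γ) = ⟨p, v⟩ := by
  subst h; rfl

variable (E Γ) in
/-- The cotangent bundle. -/
abbrev CotangentBundle : Type _ :=
  TotalSpace (E →L[ℝ] ℝ) (fun g : Γ => TangentSpace 𝓘(ℝ, E) g →L[ℝ] ℝ)

variable (E Γ) in
/-- The direct sum `TΓ ⊕ TΓ` of vector bundles over `Γ`. -/
abbrev TangentSum : Type _ :=
  TotalSpace (E × E) ((fun g : Γ => TangentSpace 𝓘(ℝ, E) g) ×ᵇ
    (fun g : Γ => TangentSpace 𝓘(ℝ, E) g))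

namespace TwoForm

variable [IsManifold 𝓘(ℝ, E) ∞ Γ] (Ω : TwoForm E Γ)

/-- The map `Ω^♭ : TΓ → T^*Γ`, `X ↦ -i_X Ω = Ω(·, X)`. -/
def flat (X : TangentBundle 𝓘(ℝ, E) Γ) : CotangentBundle E Γ :=
  ⟨X.1, -Ω.toFun X.1 X.2⟩

/-- The function `(X₁, X₂) ↦ Ω(X₁, X₂)` on `TΓ ⊕ TΓ`. -/
def onSum (X : TangentSum E Γ) : ℝ := Ω.toFun X.1 X.2.1 X.2.2

end TwoForm

namespace LieGroupoid

variable (G : LieGroupoid E EM Γ M)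

/-! ### The Lie algebroid, as a vector bundle over the base -/

/-- The fibre at `x` of the Lie algebroid `A` of `G`: the tangent space at the unit of `x` to the
source fibre. -/
def Algebroid (x : M) : Type _ :=
  (mfderiv 𝓘(ℝ, E) 𝓘(ℝ, EM) G.src (G.unit x)).ker

instance (x : M) : AddCommGroup (G.Algebroid x) :=
  inferInstanceAs (AddCommGroup (mfderiv 𝓘(ℝ, E) 𝓘(ℝ, EM) G.src (G.unit x)).ker)

instance (x : M) : Module ℝ (G.Algebroid x) :=
  inferInstanceAs (Module ℝ (mfderiv 𝓘(ℝ, E) 𝓘(ℝ, EM) G.src (G.unit x)).ker)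

instance (x : M) : TopologicalSpace (G.Algebroid x) :=
  inferInstanceAs (TopologicalSpace (mfderiv 𝓘(ℝ, E) 𝓘(ℝ, EM) G.src (G.unit x)).ker)

instance (x : M) : IsTopologicalAddGroup (G.Algebroid x) :=
  inferInstanceAs (IsTopologicalAddGroup (mfderiv 𝓘(ℝ, E) 𝓘(ℝ, EM) G.src (G.unit x)).ker)

instance (x : M) : ContinuousSMul ℝ (G.Algebroid x) :=
  inferInstanceAs (ContinuousSMul ℝ (mfderiv 𝓘(ℝ, E) 𝓘(ℝ, EM) G.src (G.unit x)).ker)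

/-- The model fibre of `A`. -/
def AlgebroidModel : Type u := G.submersion_src.complement

instance : NormedAddCommGroup G.AlgebroidModel :=
  inferInstanceAs (NormedAddCommGroup G.submersion_src.complement)

instance : NormedSpace ℝ G.AlgebroidModel :=
  inferInstanceAs (NormedSpace ℝ G.submersion_src.complement)

theorem submersionAt_unit (x : M) :
    Manifold.IsSubmersionAtOfComplement G.AlgebroidModel 𝓘(ℝ, E) 𝓘(ℝ, EM) ∞ G.src (G.unit x) :=
  G.submersion_src.isSubmersionOfComplement_complement (G.unit x)

/-- The local trivializations of `A` given by the charts in which the source is a projection. -/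
def algebroidPrebundle : VectorPrebundle ℝ G.AlgebroidModel G.Algebroid :=
  KernelBundle.prebundle G.contMDiff_unit G.submersionAt_unit

instance : TopologicalSpace (TotalSpace G.AlgebroidModel G.Algebroid) :=
  G.algebroidPrebundle.totalSpaceTopology

instance : FiberBundle G.AlgebroidModel G.Algebroid := G.algebroidPrebundle.toFiberBundle

instance : VectorBundle ℝ G.AlgebroidModel G.Algebroid := G.algebroidPrebundle.toVectorBundle

instance : ContMDiffVectorBundle ∞ G.AlgebroidModel G.Algebroid 𝓘(ℝ, EM) :=
  letI : G.algebroidPrebundle.IsContMDiff 𝓘(ℝ, EM) ∞ :=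
    KernelBundle.prebundle_isContMDiff G.contMDiff_unit G.submersionAt_unit
  G.algebroidPrebundle.contMDiffVectorBundle 𝓘(ℝ, EM)

/-- The inclusion of `A_x` in the tangent space at the unit of `x`. -/
def algebroidIncl (x : M) : G.Algebroid x →L[ℝ] TangentSpace 𝓘(ℝ, E) (G.unit x) :=
  (mfderiv 𝓘(ℝ, E) 𝓘(ℝ, EM) G.src (G.unit x)).ker.subtypeL

/-- The anchor `A_x → T_x M`: the derivative of the target. -/
def anchor (x : M) : G.Algebroid x →L[ℝ] TangentSpace 𝓘(ℝ, EM) x :=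
  (tangentCast (G.tgt_unit x)).comp
    ((mfderiv 𝓘(ℝ, E) 𝓘(ℝ, EM) G.tgt (G.unit x)).comp (G.algebroidIncl x))

/-- The total space of the dual bundle `A^*`. -/
abbrev DualAlgebroid : Type _ :=
  TotalSpace (G.AlgebroidModel →L[ℝ] ℝ) (fun x : M => G.Algebroid x →L[ℝ] ℝ)

/-! ### The tangent and cotangent groupoids -/

/-- The tangent map of the multiplication at `(g, h)`, the derivative being taken along the
submanifold of composable pairs. It is meaningful for `src g = tgt h` on the pairs `(X, Y)` that
are tangent to this submanifold, i.e. with `T src X = T tgt Y`. -/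
def tangentMul (g h : Γ) :
    TangentSpace 𝓘(ℝ, E) g × TangentSpace 𝓘(ℝ, E) h →L[ℝ] TangentSpace 𝓘(ℝ, E) (G.mul g h) :=
  mfderivWithin (𝓘(ℝ, E).prod 𝓘(ℝ, E)) 𝓘(ℝ, E) (fun z : Γ × Γ => G.mul z.1 z.2)
    {z | G.src z.1 = G.tgt z.2} (g, h)

/-- `X ∈ T_gΓ` and `Y ∈ T_hΓ` are composable in `TΓ` if `T src X = T tgt Y` in `TM`. -/
def TangentComposable {g h : Γ} (X : TangentSpace 𝓘(ℝ, E) g) (Y : TangentSpace 𝓘(ℝ, E) h) :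
    Prop :=
  tangentMap 𝓘(ℝ, E) 𝓘(ℝ, EM) G.src ⟨g, X⟩ = tangentMap 𝓘(ℝ, E) 𝓘(ℝ, EM) G.tgt ⟨h, Y⟩

/-- `V ↦ g · V`, for `V` tangent at the unit of `src g` to the target fibre: the derivative of left
translation by `g`, i.e. the product of the zero vector at `g` with `V`. -/
def leftTranslate (g : Γ) :
    TangentSpace 𝓘(ℝ, E) (G.unit (G.src g)) →L[ℝ] TangentSpace 𝓘(ℝ, E) g :=
  (tangentCast (G.mul_unit g)).comp ((G.tangentMul g (G.unit (G.src g))).comp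
    (ContinuousLinearMap.inr ℝ (TangentSpace 𝓘(ℝ, E) g)
      (TangentSpace 𝓘(ℝ, E) (G.unit (G.src g)))))

/-- `V ↦ V · g`, for `V` tangent at the unit of `tgt g` to the source fibre: the derivative of right
translation by `g`, i.e. the product of `V` with the zero vector at `g`. -/
def rightTranslate (g : Γ) :
    TangentSpace 𝓘(ℝ, E) (G.unit (G.tgt g)) →L[ℝ] TangentSpace 𝓘(ℝ, E) g :=
  (tangentCast (G.unit_mul g)).comp ((G.tangentMul (G.unit (G.tgt g)) g).comp
    (ContinuousLinearMap.inl ℝ (TangentSpace 𝓘(ℝ, E) (G.unit (G.tgt g)))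
      (TangentSpace 𝓘(ℝ, E) g)))

/-- The source `T^*Γ → A^*`: `X ↦ ξ(g · (X - ρ X))`, where `ρ X ∈ T_x M` is regarded as a tangent
vector to the submanifold of units. -/
def cotangentSrc (ξ : CotangentBundle E Γ) : G.DualAlgebroid :=
  ⟨G.src ξ.1, ξ.2.comp ((G.leftTranslate ξ.1).comp
    (G.algebroidIncl (G.src ξ.1) -
      (mfderiv 𝓘(ℝ, EM) 𝓘(ℝ, E) G.unit (G.src ξ.1)).comp (G.anchor (G.src ξ.1))))⟩

/-- The target `T^*Γ → A^*`: `X ↦ ξ(X · g)`. -/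
def cotangentTgt (ξ : CotangentBundle E Γ) : G.DualAlgebroid :=
  ⟨G.tgt ξ.1, ξ.2.comp ((G.rightTranslate ξ.1).comp (G.algebroidIncl (G.tgt ξ.1)))⟩

end LieGroupoid

/-- The structure maps of a groupoid with arrows `𝒢` and base `B` that its morphisms preserve.
`IsProd X Y Z` means that the product of `X` and `Y` is defined and equal to `Z`. -/
structure GroupoidMaps (𝒢 B : Type*) where
  src : 𝒢 → B
  tgt : 𝒢 → B
  IsProd : 𝒢 → 𝒢 → 𝒢 → Prop

/-- `Φ`, over `φ`, is a morphism of Lie groupoids: both maps are smooth and they commute with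
sources, targets and products (hence also with units and inverses). -/
structure IsLieGroupoidMorphism
    {V₁ : Type*} [NormedAddCommGroup V₁] [NormedSpace ℝ V₁] {H₁ : Type*} [TopologicalSpace H₁]
    {V₂ : Type*} [NormedAddCommGroup V₂] [NormedSpace ℝ V₂] {H₂ : Type*} [TopologicalSpace H₂]
    {V₃ : Type*} [NormedAddCommGroup V₃] [NormedSpace ℝ V₃] {H₃ : Type*} [TopologicalSpace H₃]
    {V₄ : Type*} [NormedAddCommGroup V₄] [NormedSpace ℝ V₄] {H₄ : Type*} [TopologicalSpace H₄]
    (I₁ : ModelWithCorners ℝ V₁ H₁) (I₂ : ModelWithCorners ℝ V₂ H₂)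
    (I₃ : ModelWithCorners ℝ V₃ H₃) (I₄ : ModelWithCorners ℝ V₄ H₄)
    {𝒢 : Type*} [TopologicalSpace 𝒢] [ChartedSpace H₁ 𝒢]
    {B : Type*} [TopologicalSpace B] [ChartedSpace H₂ B]
    {𝒢' : Type*} [TopologicalSpace 𝒢'] [ChartedSpace H₃ 𝒢']
    {B' : Type*} [TopologicalSpace B'] [ChartedSpace H₄ B']
    (S : GroupoidMaps 𝒢 B) (T : GroupoidMaps 𝒢' B') (Φ : 𝒢 → 𝒢') (φ : B → B') : Prop where
  contMDiff : ContMDiff I₁ I₃ ∞ Φ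
  contMDiff_base : ContMDiff I₂ I₄ ∞ φ
  src : ∀ X, T.src (Φ X) = φ (S.src X)
  tgt : ∀ X, T.tgt (Φ X) = φ (S.tgt X)
  isProd : ∀ X Y Z, S.IsProd X Y Z → T.IsProd (Φ X) (Φ Y) (Φ Z)

/-- The additive group `ℝ` as a groupoid over a point. -/
def additiveGroupoid : GroupoidMaps ℝ PUnit.{1} where
  src _ := PUnit.unit
  tgt _ := PUnit.unit
  IsProd a b c := c = a + b

namespace LieGroupoid

variable (G : LieGroupoid E EM Γ M)

/-- The tangent groupoid `TΓ ⇉ TM`: its structure maps are the tangent maps of those of `G`. -/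
def tangentGroupoid : GroupoidMaps (TangentBundle 𝓘(ℝ, E) Γ) (TangentBundle 𝓘(ℝ, EM) M) where
  src := tangentMap 𝓘(ℝ, E) 𝓘(ℝ, EM) G.src
  tgt := tangentMap 𝓘(ℝ, E) 𝓘(ℝ, EM) G.tgt
  IsProd X Y Z := G.TangentComposable X.2 Y.2 ∧
    Z = ⟨G.mul X.1 Y.1, G.tangentMul X.1 Y.1 (X.2, Y.2)⟩

/-- The cotangent groupoid `T^*Γ ⇉ A^*`. The product of `ξ ∈ T_g^*Γ` and `η ∈ T_h^*Γ` is defined if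
the source of `ξ` is the target of `η`; it is the (unique) element `ζ` of `T_{gh}^*Γ` with
`ζ(X · Y) = ξ(X) + η(Y)` for all composable `X ∈ T_gΓ`, `Y ∈ T_hΓ`. -/
def cotangentGroupoid : GroupoidMaps (CotangentBundle E Γ) G.DualAlgebroid where
  src := G.cotangentSrc
  tgt := G.cotangentTgt
  IsProd ξ η ζ := G.cotangentSrc ξ = G.cotangentTgt η ∧
    ∃ θ : TangentSpace 𝓘(ℝ, E) (G.mul ξ.1 η.1) →L[ℝ] ℝ, ζ = ⟨G.mul ξ.1 η.1, θ⟩ ∧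
      ∀ (X : TangentSpace 𝓘(ℝ, E) ξ.1) (Y : TangentSpace 𝓘(ℝ, E) η.1),
        G.TangentComposable X Y → θ (G.tangentMul ξ.1 η.1 (X, Y)) = ξ.2 X + η.2 Y

/-- The direct sum groupoid `TΓ ⊕ TΓ ⇉ TM ⊕ TM`, with componentwise structure maps. -/
def tangentSumGroupoid : GroupoidMaps (TangentSum E Γ) (TangentSum EM M) where
  src X := ⟨G.src X.1, (mfderiv 𝓘(ℝ, E) 𝓘(ℝ, EM) G.src X.1 X.2.1,
    mfderiv 𝓘(ℝ, E) 𝓘(ℝ, EM) G.src X.1 X.2.2)⟩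
  tgt X := ⟨G.tgt X.1, (mfderiv 𝓘(ℝ, E) 𝓘(ℝ, EM) G.tgt X.1 X.2.1,
    mfderiv 𝓘(ℝ, E) 𝓘(ℝ, EM) G.tgt X.1 X.2.2)⟩
  IsProd X Y Z := G.TangentComposable X.2.1 Y.2.1 ∧ G.TangentComposable X.2.2 Y.2.2 ∧
    Z = ⟨G.mul X.1 Y.1, (G.tangentMul X.1 Y.1 (X.2.1, Y.2.1),
      G.tangentMul X.1 Y.1 (X.2.2, Y.2.2))⟩

/-- The map of total spaces `TM → A^*` given by a family of linear maps of the fibres. -/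
def bundleMap (w : ∀ x : M, TangentSpace 𝓘(ℝ, EM) x →L[ℝ] G.Algebroid x →L[ℝ] ℝ)
    (v : TangentBundle 𝓘(ℝ, EM) M) : G.DualAlgebroid :=
  ⟨v.1, w v.1 v.2⟩

end LieGroupoid

end

/-!
The equivalence of the last three properties is mostly a matter of definitions: evaluating the
equality `Ω^♭(X₁ · Y₁) = Ω^♭(X₁) · Ω^♭(Y₁)` on a product `X₂ · Y₂` is the additivity of `Ω`. Two
points need an argument.

The first is that an additive `Ω` makes `Ω^♭(X)` and `Ω^♭(Y)` composable whenever `X` and `Y` are.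
For `a` in the Lie algebroid at the common base point of `g` and `h`, the vectors `g · (ρ a - a)` and
`a · h` are composable and have product zero
(`LieGroupoid.tangentComposable_leftTranslate_rightTranslate`), because they are the velocities of
`g k⁻¹` and `k h` for a curve `k` in a source fibre, and `(g k⁻¹) (k h) = g h` is constant. Hence
`0 = Ω(X · Y, 0) = Ω(X, g · (ρ a - a)) + Ω(Y, a · h)`, which says that the source of `Ω^♭(X)` is the
target of `Ω^♭(Y)` (`LieGroupoid.cotangentSrc_flat_eq_cotangentTgt_flat`).

The second is that `Ω^♭`, once it preserves products, covers a vector-bundle morphism `TM → A^*`.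
This must be the restriction of `Ω^♭` to the units, `v ↦ -Ω(T1 v, ·)` (`LieGroupoid.baseFlat`), and
compatibility with source and target follows since `X` is composable with the units at its source
and target. Its smoothness is read off in the local trivialization of `A`, where the constant
sections are smooth vertical vector fields along the units.

Derivatives of the product are taken along the set of composable pairs, which is not a set of unique
differentiability. They are computed on velocities of curves of composable pairs
(`IsVelocity.mul`), and every vector of the Lie algebroid is the velocity of a curve in a source
fibre (`Manifold.IsSubmersionAtOfComplement.exists_isVelocity`).
-/

/-! ### Velocities of curves -/

/-- The curve `c` in `N` is differentiable at `0` with velocity `V`. The velocity is an element of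
the total space of the tangent bundle, so that no identification of tangent spaces at propositionally
equal points is needed. -/
def IsVelocity {E : Type*} [NormedAddCommGroup E] [NormedSpace ℝ E]
    {N : Type*} [TopologicalSpace N] [ChartedSpace E N]
    (c : ℝ → N) (V : TangentBundle 𝓘(ℝ, E) N) : Prop :=
  MDifferentiableAt 𝓘(ℝ, ℝ) 𝓘(ℝ, E) c 0 ∧
    tangentMap 𝓘(ℝ, ℝ) 𝓘(ℝ, E) c ⟨0, (1 : ℝ)⟩ = V

namespace IsVelocity

variable {E : Type*} [NormedAddCommGroup E] [NormedSpace ℝ E]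
  {EM : Type*} [NormedAddCommGroup EM] [NormedSpace ℝ EM]
  {Γ : Type*} [TopologicalSpace Γ] [ChartedSpace E Γ]
  {M : Type*} [TopologicalSpace M] [ChartedSpace EM M]
  {c c' : ℝ → Γ} {V W : TangentBundle 𝓘(ℝ, E) Γ}

theorem apply_zero (h : IsVelocity c V) : c 0 = V.1 := congrArg TotalSpace.proj h.2

theorem congr (h : IsVelocity c V) (hc : c' =ᶠ[nhds 0] c) : IsVelocity c' V := by
  refine ⟨h.1.congr_of_eventuallyEq hc, ?_⟩
  rw [← h.2]
  have h0 : c' 0 = c 0 := hc.self_of_nhds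
  have h1 := hc.mfderiv_eq (I := 𝓘(ℝ, ℝ)) (I' := 𝓘(ℝ, E))
  exact TotalSpace.ext h0 (heq_of_eq (congrArg (fun T : ℝ →L[ℝ] E => T 1) h1))

theorem unique (h : IsVelocity c V) (h' : IsVelocity c W) : V = W := h.2.symm.trans h'.2

theorem const (g : Γ) : IsVelocity (fun _ : ℝ => g) (⟨g, 0⟩ : TangentBundle 𝓘(ℝ, E) Γ) := by
  refine ⟨mdifferentiableAt_const, ?_⟩
  simp only [tangentMap, mfderiv_const]
  rfl

theorem comp {f : Γ → M} (h : IsVelocity c V) (hf : MDifferentiableAt 𝓘(ℝ, E) 𝓘(ℝ, EM) f V.1) :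
    IsVelocity (fun t => f (c t)) (tangentMap 𝓘(ℝ, E) 𝓘(ℝ, EM) f V) := by
  rw [← h.apply_zero] at hf
  refine ⟨hf.comp 0 h.1, ?_⟩
  rw [← h.2]
  exact tangentMap_comp_at (p := ⟨0, (1 : ℝ)⟩) hf h.1

end IsVelocity

/-- A vector killed by the derivative of a submersion is the velocity of a curve in the fibre:
the affine curve in a chart in which the submersion is a linear projection. -/
theorem Manifold.IsSubmersionAtOfComplement.exists_isVelocity
    {E : Type*} [NormedAddCommGroup E] [NormedSpace ℝ E]
    {EM : Type*} [NormedAddCommGroup EM] [NormedSpace ℝ EM]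
    {F : Type*} [NormedAddCommGroup F] [NormedSpace ℝ F]
    {Γ : Type*} [TopologicalSpace Γ] [ChartedSpace E Γ]
    {M : Type*} [TopologicalSpace M] [ChartedSpace EM M] {f : Γ → M} {p : Γ}
    (h : Manifold.IsSubmersionAtOfComplement F 𝓘(ℝ, E) 𝓘(ℝ, EM) ∞ f p)
    (v : TangentSpace 𝓘(ℝ, E) p) (hv : mfderiv 𝓘(ℝ, E) 𝓘(ℝ, EM) f p v = 0) :
    ∃ c : ℝ → Γ, IsVelocity c (⟨p, v⟩ : TangentBundle 𝓘(ℝ, E) Γ) ∧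
      ∀ᶠ t in nhds 0, f (c t) = f p := by
  have hp := h.mem_domChart_source
  rw [KernelBundle.mem_ker_iff h hp] at hv
  set φ := h.domChart
  let u : E := mfderiv 𝓘(ℝ, E) 𝓘(ℝ, E) φ p v
  let l : ℝ → E := fun t => φ p + t • u
  have hl0 : l 0 = φ p := by simp [l]
  have hld : HasDerivAt l u 0 := by
    simpa [l] using ((hasDerivAt_id (0 : ℝ)).smul_const u).const_add (φ p)
  have hlv : IsVelocity l (⟨φ p, u⟩ : TangentBundle 𝓘(ℝ, E) E) := by
    refine ⟨hld.differentiableAt.mdifferentiableAt, ?_⟩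
    refine TotalSpace.ext hl0 (heq_of_eq ?_)
    change (mfderiv 𝓘(ℝ, ℝ) 𝓘(ℝ, E) l 0 : ℝ →L[ℝ] E) (1 : ℝ) = u
    rw [mfderiv_eq_fderiv]
    exact (congrArg (fun T : ℝ →L[ℝ] E => T 1) hld.hasFDerivAt.fderiv).trans (one_smul ℝ u)
  have hs : MDifferentiableAt 𝓘(ℝ, E) 𝓘(ℝ, E) φ.symm (φ p) :=
    KernelBundle.mdiff_symm h.domChart_mem_maximalAtlas (φ.map_source hp)
  have hev : ∀ᶠ t in nhds (0 : ℝ), l t ∈ φ.target :=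
    hld.continuousAt.eventually_mem (φ.open_target.mem_nhds (hl0 ▸ φ.map_source hp))
  refine ⟨fun t => φ.symm (l t), ?_, ?_⟩
  · have h1 := hlv.comp (f := φ.symm) hs
    have h2 : tangentMap 𝓘(ℝ, E) 𝓘(ℝ, E) φ.symm (⟨φ p, u⟩ : TangentBundle 𝓘(ℝ, E) E) =
        (⟨p, v⟩ : TangentBundle 𝓘(ℝ, E) Γ) := by
      have hd := KernelBundle.mdiff h.domChart_mem_maximalAtlas hp
      have hs' : MDifferentiableAt 𝓘(ℝ, E) 𝓘(ℝ, E) φ.symm (φ p) := hs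
      have h3 := tangentMap_comp_at (p := (⟨p, v⟩ : TangentBundle 𝓘(ℝ, E) Γ)) hs' hd
      have hid : φ.symm ∘ φ =ᶠ[nhds p] id := by
        filter_upwards [φ.open_source.mem_nhds hp] with y hy using φ.left_inv hy
      refine h3.symm.trans ?_
      refine TotalSpace.ext (φ.left_inv hp) (heq_of_eq ?_)
      have h4 := hid.mfderiv_eq (I := 𝓘(ℝ, E)) (I' := 𝓘(ℝ, E))
      rw [mfderiv_id] at h4
      exact congrArg (fun T : E →L[ℝ] E => T v) h4
    rwa [h2] at h1
  · filter_upwards [hev] with t ht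
    have hsrc := φ.map_target ht
    have key : ∀ q ∈ φ.source, h.codChart (f q) = (h.equiv (φ q)).1 := by
      intro q hq
      have := h.writtenInCharts ((h.domChart.extend 𝓘(ℝ, E)).map_source
        ((h.domChart.extend_source (I := 𝓘(ℝ, E))).symm ▸ hq))
      simpa [φ, h.domChart.left_inv hq] using this
    refine h.codChart.injOn (h.source_subset_preimage_source hsrc)
      (h.source_subset_preimage_source hp) ?_
    rw [key _ hsrc, key _ hp, φ.right_inv ht]
    have : (h.equiv u).1 = 0 := hv
    simp [l, this]

/-! ### Derivatives of the structure maps -/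

namespace LieGroupoid

variable {E : Type*} [NormedAddCommGroup E] [NormedSpace ℝ E]
  {EM : Type*} [NormedAddCommGroup EM] [NormedSpace ℝ EM]
  {Γ : Type*} [TopologicalSpace Γ] [ChartedSpace E Γ]
  {M : Type*} [TopologicalSpace M] [ChartedSpace EM M]
  (G : LieGroupoid E EM Γ M)

theorem mdifferentiable_src : MDifferentiable 𝓘(ℝ, E) 𝓘(ℝ, EM) G.src := fun g =>
  (G.submersion_src.isSubmersionOfComplement_complement g).contMDiffAt.mdifferentiableAt (by simp)

theorem mdifferentiable_tgt : MDifferentiable 𝓘(ℝ, E) 𝓘(ℝ, EM) G.tgt := fun g =>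
  (G.submersion_tgt.isSubmersionOfComplement_complement g).contMDiffAt.mdifferentiableAt (by simp)

theorem mdifferentiable_unit : MDifferentiable 𝓘(ℝ, EM) 𝓘(ℝ, E) G.unit :=
  G.contMDiff_unit.mdifferentiable (by simp)

theorem mdifferentiable_inv : MDifferentiable 𝓘(ℝ, E) 𝓘(ℝ, E) G.inv :=
  G.contMDiff_inv.mdifferentiable (by simp)

variable {G} in
/-- The chain rule for `tangentMul`. Although the set of composable pairs is not a set of unique
differentiability, the derivative along it is determined on velocities of curves in it. -/
theorem _root_.IsVelocity.mul {c c' : ℝ → Γ} {X Y : TangentBundle 𝓘(ℝ, E) Γ}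
    (hX : IsVelocity c X) (hY : IsVelocity c' Y)
    (h : ∀ᶠ t in nhds 0, G.src (c t) = G.tgt (c' t)) :
    IsVelocity (fun t => G.mul (c t) (c' t))
      (⟨G.mul X.1 Y.1, G.tangentMul X.1 Y.1 (X.2, Y.2)⟩ : TangentBundle 𝓘(ℝ, E) Γ) := by
  obtain ⟨hc, rfl⟩ := hX
  obtain ⟨hc', rfl⟩ := hY
  have h0 : G.src (c 0) = G.tgt (c' 0) := h.self_of_nhds
  have hm : HasMFDerivWithinAt (𝓘(ℝ, E).prod 𝓘(ℝ, E)) 𝓘(ℝ, E)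
      (fun z : Γ × Γ => G.mul z.1 z.2) {z | G.src z.1 = G.tgt z.2} (c 0, c' 0)
      (G.tangentMul (c 0) (c' 0)) :=
    ((G.contMDiffOn_mul (c 0, c' 0) h0).mdifferentiableWithinAt (by simp)).hasMFDerivWithinAt
  have hp := (hc.hasMFDerivAt.prodMk hc'.hasMFDerivAt).hasMFDerivWithinAt
    (s := {t | G.src (c t) = G.tgt (c' t)})
  have hd := (HasMFDerivWithinAt.comp (f := fun t => (c t, c' t)) 0 hm hp
    (fun t ht => ht)).hasMFDerivAt h
  refine ⟨hd.mdifferentiableAt, TotalSpace.ext rfl (heq_of_eq ?_)⟩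
  exact congrArg (fun T : ℝ →L[ℝ] E => T 1) hd.mfderiv

theorem mul_inv_mul {g h k : Γ} (h1 : G.src g = G.src k) (h2 : G.src k = G.tgt h) :
    G.mul (G.mul g (G.inv k)) (G.mul k h) = G.mul g h := by
  rw [G.mul_assoc _ _ _ (h1.trans (G.tgt_inv k).symm)
      ((G.src_inv k).trans (G.tgt_mul k h h2).symm),
    ← G.mul_assoc _ _ _ (G.src_inv k) h2, G.inv_mul, h2, G.unit_mul]

/-- A vector `a` of the Lie algebroid is the velocity of a curve in a source fibre. -/
theorem exists_isVelocity_algebroidIncl {x : M} (a : G.Algebroid x) :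
    ∃ k : ℝ → Γ, IsVelocity k (⟨G.unit x, G.algebroidIncl x a⟩ : TangentBundle 𝓘(ℝ, E) Γ) ∧
      ∀ᶠ t in nhds 0, G.src (k t) = x := by
  obtain ⟨k, hk, hs⟩ := (G.submersionAt_unit x).exists_isVelocity (G.algebroidIncl x a) a.2
  exact ⟨k, hk, by simpa [G.src_unit] using hs⟩

theorem tangentMap_tgt_algebroidIncl {x : M} (a : G.Algebroid x) :
    tangentMap 𝓘(ℝ, E) 𝓘(ℝ, EM) G.tgt ⟨G.unit x, G.algebroidIncl x a⟩ = ⟨x, G.anchor x a⟩ :=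
  (mk_tangentCast (G.tgt_unit x) _).symm

theorem inv_unit (x : M) : G.inv (G.unit x) = G.unit x := by
  have h := G.unit_mul (G.inv (G.unit x))
  rw [G.tgt_inv, G.src_unit] at h
  have h' := G.mul_inv (G.unit x)
  rw [G.tgt_unit] at h'
  exact h.symm.trans h'

theorem _root_.Bundle.TotalSpace.mk_add_mk {B F : Type*} {V : B → Type*}
    [∀ b, Add (V b)] {p q : B} {u v : V p} {u' v' : V q}
    (hu : (⟨p, u⟩ : TotalSpace F V) = ⟨q, u'⟩) (hv : (⟨p, v⟩ : TotalSpace F V) = ⟨q, v'⟩) :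
    (⟨p, u + v⟩ : TotalSpace F V) = ⟨q, u' + v'⟩ := by
  obtain rfl : p = q := congrArg TotalSpace.proj hu
  rw [TotalSpace.mk_inj] at hu hv
  rw [hu, hv]

/-- On the Lie algebroid, the derivative of the inversion is `a ↦ ρ a - a`. This follows from
`k k⁻¹ = 1` and the linearity of the derivative of the product at `(1, 1)`. -/
theorem tangentMap_inv_algebroidIncl {x : M} (a : G.Algebroid x) :
    tangentMap 𝓘(ℝ, E) 𝓘(ℝ, E) G.inv ⟨G.unit x, G.algebroidIncl x a⟩ =
      ⟨G.unit x, mfderiv 𝓘(ℝ, EM) 𝓘(ℝ, E) G.unit x (G.anchor x a) - G.algebroidIncl x a⟩ := by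
  obtain ⟨k, hk, hs⟩ := G.exists_isVelocity_algebroidIncl a
  have hki := hk.comp (G.mdifferentiable_inv _)
  obtain ⟨b, hb⟩ : ∃ b : TangentSpace 𝓘(ℝ, E) (G.unit x),
      tangentMap 𝓘(ℝ, E) 𝓘(ℝ, E) G.inv ⟨G.unit x, G.algebroidIncl x a⟩ = ⟨G.unit x, b⟩ := by
    refine ⟨tangentCast (G.inv_unit x) (mfderiv 𝓘(ℝ, E) 𝓘(ℝ, E) G.inv (G.unit x)
      (G.algebroidIncl x a)), ?_⟩
    rw [mk_tangentCast]
    rfl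
  rw [hb] at hki ⊢
  have hc := IsVelocity.const (E := E) (G.unit x)
  -- `h1` and `h2` say that the product of `(a, 0)` is `a` and that of `(0, b)` is `b`.
  have h1 := (hk.mul (G := G) hc (hs.mono fun t ht => by rw [ht, G.tgt_unit])).unique
    (hk.congr (hs.mono fun t ht => by simpa only [ht] using G.mul_unit (k t)))
  have h2 := (hc.mul (G := G) hki (hs.mono fun t ht => by rw [G.tgt_inv, ht, G.src_unit])).unique
    (hki.congr (hs.mono fun t ht => by
      simpa only [G.tgt_inv, ht] using G.unit_mul (G.inv (k t))))
  -- The velocity of `k k⁻¹ = 1` gives the product of `(a, b)`.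
  have hm := hk.mul (G := G) hki (Filter.Eventually.of_forall fun t => (G.tgt_inv (k t)).symm)
  simp only [G.mul_inv] at hm
  have ht := hk.comp (G.mdifferentiable_tgt _)
  rw [tangentMap_tgt_algebroidIncl] at ht
  have h3 := hm.unique (ht.comp (G.mdifferentiable_unit _))
  have h4 := TotalSpace.mk_add_mk h1 h2
  rw [← map_add, Prod.mk_add_mk, add_zero, zero_add, h3] at h4
  have h5 : mfderiv 𝓘(ℝ, EM) 𝓘(ℝ, E) G.unit x (G.anchor x a) = G.algebroidIncl x a + b :=
    (TotalSpace.mk_inj ..).1 h4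
  rw [h5, add_sub_cancel_left]

theorem mk_leftTranslate {g : Γ} (V : TangentSpace 𝓘(ℝ, E) (G.unit (G.src g))) :
    (⟨g, G.leftTranslate g V⟩ : TangentBundle 𝓘(ℝ, E) Γ) =
      ⟨G.mul g (G.unit (G.src g)), G.tangentMul g (G.unit (G.src g)) (0, V)⟩ :=
  mk_tangentCast _ _

theorem mk_rightTranslate {g : Γ} (V : TangentSpace 𝓘(ℝ, E) (G.unit (G.tgt g))) :
    (⟨g, G.rightTranslate g V⟩ : TangentBundle 𝓘(ℝ, E) Γ) =
      ⟨G.mul (G.unit (G.tgt g)) g, G.tangentMul (G.unit (G.tgt g)) g (V, 0)⟩ :=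
  mk_tangentCast _ _

/-- Right translation by a unit is the identity on the Lie algebroid. -/
theorem mk_rightTranslate_unit {x : M} (a : G.Algebroid (G.tgt (G.unit x))) :
    (⟨G.unit x, G.rightTranslate (G.unit x) (G.algebroidIncl _ a)⟩ : TangentBundle 𝓘(ℝ, E) Γ) =
      ⟨G.unit (G.tgt (G.unit x)), G.algebroidIncl _ a⟩ := by
  obtain ⟨k, hk, hs⟩ := G.exists_isVelocity_algebroidIncl a
  rw [mk_rightTranslate]
  refine (hk.mul (G := G) (IsVelocity.const (E := E) (G.unit x)) hs).unique (hk.congr ?_)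
  filter_upwards [hs] with t ht
  simpa only [ht, G.tgt_unit] using G.mul_unit (k t)

/-- The vectors `g · (ρ a - a)` and `a · h` are composable and their product is zero: they are the
velocities of `g k⁻¹` and `k h` for a curve `k` in a source fibre, and `(g k⁻¹) (k h) = g h`. -/
theorem tangentComposable_leftTranslate_rightTranslate {g h : Γ} (hgh : G.src g = G.tgt h)
    (a : G.Algebroid (G.src g)) (a' : G.Algebroid (G.tgt h))
    (haa' : (⟨_, G.algebroidIncl _ a⟩ : TangentBundle 𝓘(ℝ, E) Γ) = ⟨_, G.algebroidIncl _ a'⟩) :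
    let X := G.leftTranslate g (mfderiv 𝓘(ℝ, EM) 𝓘(ℝ, E) G.unit _ (G.anchor _ a) -
      G.algebroidIncl _ a)
    let Y := G.rightTranslate h (G.algebroidIncl _ a')
    G.TangentComposable X Y ∧ G.tangentMul g h (X, Y) = 0 := by
  intro X Y
  obtain ⟨k, hk, hs⟩ := G.exists_isVelocity_algebroidIncl a
  have hki := hk.comp (G.mdifferentiable_inv _)
  rw [tangentMap_inv_algebroidIncl] at hki
  have h1 := (IsVelocity.const (E := E) g).mul (G := G) hki
    (hs.mono fun t ht => by rw [G.tgt_inv, ht])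
  rw [← mk_leftTranslate] at h1
  have hk' := hk
  rw [haa'] at hk'
  have h2 := hk'.mul (G := G) (IsVelocity.const (E := E) h) (hs.mono fun t ht => ht.trans hgh)
  rw [← mk_rightTranslate] at h2
  -- The source of `g k⁻¹` and the target of `k h` are both the target of `k`.
  have h3 := (h1.comp (G.mdifferentiable_src _)).congr (c' := fun t => G.tgt (k t))
    (hs.mono fun t ht => by
      simpa only [G.src_inv] using (G.src_mul g (G.inv (k t)) (by rw [G.tgt_inv, ht])).symm)
  have h4 := (h2.comp (G.mdifferentiable_tgt _)).congr (c' := fun t => G.tgt (k t))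
    (hs.mono fun t ht => (G.tgt_mul (k t) h (ht.trans hgh)).symm)
  refine ⟨h3.unique h4, ?_⟩
  have h5 := h1.mul (G := G) h2 (hs.mono fun t ht => by
    rw [G.src_mul _ _ (by rw [G.tgt_inv, ht]), G.src_inv, G.tgt_mul _ _ (ht.trans hgh)])
  have h6 := (IsVelocity.const (E := E) (G.mul g h)).congr (hs.mono fun t ht =>
    G.mul_inv_mul (k := k t) ht.symm (ht.trans hgh))
  exact (TotalSpace.mk_inj ..).1 (h5.unique h6)

end LieGroupoid

/-! ### Smoothness of the maps defined by a 2-form -/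

section Bundles

variable {B EB HB F₁ F₂ : Type*} [NormedAddCommGroup EB] [NormedSpace ℝ EB]
  [TopologicalSpace HB] {IB : ModelWithCorners ℝ EB HB} [TopologicalSpace B] [ChartedSpace HB B]
  [NormedAddCommGroup F₁] [NormedSpace ℝ F₁] [NormedAddCommGroup F₂] [NormedSpace ℝ F₂]
  {E₁ E₂ : B → Type*} [∀ x, Zero (E₁ x)] [∀ x, Zero (E₂ x)]
  [∀ x, TopologicalSpace (E₁ x)] [∀ x, TopologicalSpace (E₂ x)]
  [TopologicalSpace (TotalSpace F₁ E₁)] [TopologicalSpace (TotalSpace F₂ E₂)]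
  [FiberBundle F₁ E₁] [FiberBundle F₂ E₂] {n : WithTop ℕ∞}

theorem Bundle.Prod.contMDiff_fst :
    ContMDiff (IB.prod 𝓘(ℝ, F₁ × F₂)) (IB.prod 𝓘(ℝ, F₁)) n
      (fun X : TotalSpace (F₁ × F₂) (E₁ ×ᵇ E₂) => (⟨X.1, X.2.1⟩ : TotalSpace F₁ E₁)) := by
  intro X
  have h := (contMDiffAt_totalSpace.1 (contMDiffAt_id (I := IB.prod 𝓘(ℝ, F₁ × F₂)) (n := n)
    (x := X)))
  exact contMDiffAt_totalSpace.2
    ⟨h.1, (ContinuousLinearMap.fst ℝ F₁ F₂).contMDiff.contMDiffAt.comp X h.2⟩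

theorem Bundle.Prod.contMDiff_snd :
    ContMDiff (IB.prod 𝓘(ℝ, F₁ × F₂)) (IB.prod 𝓘(ℝ, F₂)) n
      (fun X : TotalSpace (F₁ × F₂) (E₁ ×ᵇ E₂) => (⟨X.1, X.2.2⟩ : TotalSpace F₂ E₂)) := by
  intro X
  have h := (contMDiffAt_totalSpace.1 (contMDiffAt_id (I := IB.prod 𝓘(ℝ, F₁ × F₂)) (n := n)
    (x := X)))
  exact contMDiffAt_totalSpace.2
    ⟨h.1, (ContinuousLinearMap.snd ℝ F₁ F₂).contMDiff.contMDiffAt.comp X h.2⟩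

end Bundles

/-- A family of functionals on a finite-dimensional space is smooth if its values are. -/
theorem contMDiffAt_clm_of_apply
    {F : Type*} [NormedAddCommGroup F] [NormedSpace ℝ F] [FiniteDimensional ℝ F]
    {EN HN N : Type*} [NormedAddCommGroup EN] [NormedSpace ℝ EN] [TopologicalSpace HN]
    {I : ModelWithCorners ℝ EN HN} [TopologicalSpace N] [ChartedSpace HN N]
    {n : WithTop ℕ∞} {f : N → F →L[ℝ] ℝ} {x : N}
    (h : ∀ y, ContMDiffAt I 𝓘(ℝ, ℝ) n (fun p => f p y) x) :
    ContMDiffAt I 𝓘(ℝ, F →L[ℝ] ℝ) n f x := by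
  let b := Module.finBasis ℝ F
  have hf : f = fun p => ∑ i, f p (b i) • LinearMap.toContinuousLinearMap (b.coord i) := by
    funext p
    ext y
    conv_lhs => rw [← b.sum_repr y, map_sum]
    simp [mul_comm]
  rw [hf]
  exact ContMDiffAt.sum fun i _ => (h (b i)).smul contMDiffAt_const

namespace TwoForm

variable {E : Type*} [NormedAddCommGroup E] [NormedSpace ℝ E]
  {Γ : Type*} [TopologicalSpace Γ] [ChartedSpace E Γ] [IsManifold 𝓘(ℝ, E) ∞ Γ]
  (Ω : TwoForm E Γ)

theorem contMDiff_flat :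
    ContMDiff 𝓘(ℝ, E).tangent (𝓘(ℝ, E).prod 𝓘(ℝ, E →L[ℝ] ℝ)) ∞ Ω.flat := by
  intro X
  have hp := contMDiff_proj (IB := 𝓘(ℝ, E)) (n := ∞) (F := E) (TangentSpace 𝓘(ℝ, E) : Γ → Type _)
  have h := ContMDiffAt.clm_bundle_apply (E₂ := fun g : Γ => TangentSpace 𝓘(ℝ, E) g →L[ℝ] ℝ)
    (b := fun X : TangentBundle 𝓘(ℝ, E) Γ => X.1) (ϕ := fun X => Ω.toFun X.1) (v := fun X => X.2)
    ((Ω.contMDiff.comp hp) X) contMDiffAt_id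
  rw [contMDiffAt_hom_bundle] at h ⊢
  refine ⟨h.1, h.2.neg.congr_of_eventuallyEq (Filter.Eventually.of_forall fun Y => ?_)⟩
  simp only [flat, ContinuousLinearMap.inCoordinates]
  rw [ContinuousLinearMap.neg_comp, ContinuousLinearMap.comp_neg]

/-- The values of a 2-form on vector fields along a map are smooth. -/
theorem contMDiffAt_apply₂
    {EN HN N : Type*} [NormedAddCommGroup EN] [NormedSpace ℝ EN] [TopologicalSpace HN]
    {I : ModelWithCorners ℝ EN HN} [TopologicalSpace N] [ChartedSpace HN N]
    {b : N → Γ} {X Y : ∀ p, TangentSpace 𝓘(ℝ, E) (b p)} {p : N}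
    (hX : ContMDiffAt I 𝓘(ℝ, E).tangent ∞
      (fun p => (⟨b p, X p⟩ : TangentBundle 𝓘(ℝ, E) Γ)) p)
    (hY : ContMDiffAt I 𝓘(ℝ, E).tangent ∞
      (fun p => (⟨b p, Y p⟩ : TangentBundle 𝓘(ℝ, E) Γ)) p) :
    ContMDiffAt I 𝓘(ℝ, ℝ) ∞ (fun p => Ω.toFun (b p) (X p) (Y p)) p := by
  have hb : ContMDiffAt I 𝓘(ℝ, E) ∞ b p := (contMDiffAt_totalSpace.1 hX).1
  have h := (Ω.contMDiff.contMDiffAt (x := b p)).comp p hb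
  have h' := ContMDiffAt.clm_bundle_apply₂ (E₃ := Bundle.Trivial Γ ℝ) h hX hY
  exact (contMDiffAt_totalSpace.1 h').2

theorem contMDiff_onSum :
    ContMDiff (𝓘(ℝ, E).prod 𝓘(ℝ, E × E)) 𝓘(ℝ, ℝ) ∞ Ω.onSum := fun X =>
  Ω.contMDiffAt_apply₂ (b := fun X : TangentSum E Γ => X.1)
    (Bundle.Prod.contMDiff_fst X) (Bundle.Prod.contMDiff_snd X)

end TwoForm

/-- In a chart in which a submersion is a projection, the vertical vector fields with constant
components are smooth. -/
theorem KernelBundle.contMDiffAt_symm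
    {E : Type*} [NormedAddCommGroup E] [NormedSpace ℝ E]
    {EM : Type*} [NormedAddCommGroup EM] [NormedSpace ℝ EM]
    {F : Type*} [NormedAddCommGroup F] [NormedSpace ℝ F]
    {Γ : Type*} [TopologicalSpace Γ] [ChartedSpace E Γ] [IsManifold 𝓘(ℝ, E) ∞ Γ]
    {M : Type*} [TopologicalSpace M] [ChartedSpace EM M] {f : Γ → M} {p : Γ}
    (h : Manifold.IsSubmersionAtOfComplement F 𝓘(ℝ, E) 𝓘(ℝ, EM) ∞ f p) (w : F)
    {q : Γ} (hq : q ∈ h.domChart.source) :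
    ContMDiffAt 𝓘(ℝ, E) 𝓘(ℝ, E).tangent ∞
      (fun q => (⟨q, symm h q w⟩ : TangentBundle 𝓘(ℝ, E) Γ)) q := by
  set φ := h.domChart
  have hφm := h.domChart_mem_maximalAtlas
  let u : E := h.equiv.symm ((0, w) : EM × F)
  -- The field is the image of a constant field on the model space under the derivative of `φ⁻¹`.
  have h1 : ContMDiffAt 𝓘(ℝ, E) 𝓘(ℝ, E).tangent ∞
      (fun q => (⟨φ q, u⟩ : TangentBundle 𝓘(ℝ, E) E)) q := by
    have hc : ContMDiff 𝓘(ℝ, E) 𝓘(ℝ, E).tangent ∞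
        (fun y : E => (⟨y, u⟩ : TangentBundle 𝓘(ℝ, E) E)) := by
      intro y
      refine contMDiffAt_totalSpace.2 ⟨contMDiffAt_id, ?_⟩
      simpa using contMDiffAt_const
    exact (hc (φ q)).comp q (contMDiffAt_of_mem_maximalAtlas hφm hq)
  have h2 : ContMDiffOn 𝓘(ℝ, E).tangent 𝓘(ℝ, E).tangent ∞
      (tangentMapWithin 𝓘(ℝ, E) 𝓘(ℝ, E) φ.symm φ.target)
      (π E (TangentSpace 𝓘(ℝ, E)) ⁻¹' φ.target) :=
    (contMDiffOn_symm_of_mem_maximalAtlas hφm).contMDiffOn_tangentMapWithin (by simp)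
      φ.open_target.uniqueMDiffOn
  have h3 := (h2.contMDiffAt (x := (⟨φ q, u⟩ : TangentBundle 𝓘(ℝ, E) E))
    ((φ.open_target.preimage (FiberBundle.continuous_proj E _)).mem_nhds
      (φ.map_source hq))).comp q h1
  refine h3.congr_of_eventuallyEq ?_
  filter_upwards [φ.open_source.mem_nhds hq] with y hy
  refine TotalSpace.ext (φ.left_inv hy).symm (heq_of_eq ?_)
  have hd : φ.MDifferentiable 𝓘(ℝ, E) 𝓘(ℝ, E) :=
    ⟨fun q hq => (mdiff hφm hq).mdifferentiableWithinAt,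
      fun q hq => (mdiff_symm hφm hq).mdifferentiableWithinAt⟩
  have h4 : mfderivWithin 𝓘(ℝ, E) 𝓘(ℝ, E) φ.symm φ.target (φ y) =
      mfderiv 𝓘(ℝ, E) 𝓘(ℝ, E) φ.symm (φ y) :=
    mfderivWithin_of_isOpen φ.open_target (φ.map_source hy)
  have h5 : (mfderiv 𝓘(ℝ, E) 𝓘(ℝ, E) φ y : E →L[ℝ] E).inverse =
      (mfderiv 𝓘(ℝ, E) 𝓘(ℝ, E) φ.symm (φ y) : E →L[ℝ] E) :=
    ContinuousLinearMap.inverse_equiv (hd.mfderiv hy)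
  exact (congrArg (fun T : E →L[ℝ] E => T u) (h5.trans h4.symm))

namespace LieGroupoid

variable {E : Type*} [NormedAddCommGroup E] [NormedSpace ℝ E]
  {EM : Type*} [NormedAddCommGroup EM] [NormedSpace ℝ EM]
  {Γ : Type*} [TopologicalSpace Γ] [ChartedSpace E Γ]
  {M : Type*} [TopologicalSpace M] [ChartedSpace EM M]
  (G : LieGroupoid E EM Γ M)

theorem finiteDimensional_algebroidModel [FiniteDimensional ℝ E] [Nonempty M] :
    FiniteDimensional ℝ G.AlgebroidModel := by
  obtain ⟨x⟩ := ‹Nonempty M›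
  have h := G.submersionAt_unit x
  let L : E →ₗ[ℝ] G.AlgebroidModel :=
    LinearMap.snd ℝ EM G.AlgebroidModel ∘ₗ h.equiv.toLinearEquiv.toLinearMap
  exact Module.Finite.of_surjective L (Prod.snd_surjective.comp h.equiv.surjective)

/-- The local trivialization of the Lie algebroid is given by the vertical components in a chart
adapted to the source. -/
theorem trivializationAt_algebroid_symm {x₀ x : M}
    (hx : G.unit x ∈ (G.submersionAt_unit x₀).domChart.source) (w : G.AlgebroidModel) :
    G.algebroidIncl x ((trivializationAt G.AlgebroidModel G.Algebroid x₀).symm x w) =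
      KernelBundle.symm (G.submersionAt_unit x₀) (G.unit x) w := by
  have h := KernelBundle.triv_symm G.contMDiff_unit.continuous (G.submersionAt_unit x₀) hx w
  exact congrArg Subtype.val h

variable [IsManifold 𝓘(ℝ, E) ∞ Γ]

/-- The vector-bundle morphism `TM → A^*` induced by a 2-form: `v ↦ Ω(·, T1 v)` along the units. -/
noncomputable def baseFlat (Ω : TwoForm E Γ) (x : M) :
    TangentSpace 𝓘(ℝ, EM) x →L[ℝ] G.Algebroid x →L[ℝ] ℝ :=
  -((ContinuousLinearMap.precomp ℝ (G.algebroidIncl x)).comp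
      ((Ω.toFun (G.unit x)).comp (mfderiv 𝓘(ℝ, EM) 𝓘(ℝ, E) G.unit x)))

theorem baseFlat_apply (Ω : TwoForm E Γ) {x : M} (v : TangentSpace 𝓘(ℝ, EM) x)
    (a : G.Algebroid x) : G.baseFlat Ω x v a =
      -Ω.toFun (G.unit x) (mfderiv 𝓘(ℝ, EM) 𝓘(ℝ, E) G.unit x v) (G.algebroidIncl x a) := rfl

/-- In the local trivialization of `A`, the components of the functional induced by `v` are the
values of `Ω` on `T1 v` and the vertical vector fields with constant components. -/
theorem contMDiff_bundleMap_baseFlat [IsManifold 𝓘(ℝ, EM) ∞ M] [FiniteDimensional ℝ E]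
    (Ω : TwoForm E Γ) :
    ContMDiff 𝓘(ℝ, EM).tangent (𝓘(ℝ, EM).prod 𝓘(ℝ, G.AlgebroidModel →L[ℝ] ℝ)) ∞
      (G.bundleMap (G.baseFlat Ω)) := by
  intro v
  have : Nonempty M := ⟨v.1⟩
  have := G.finiteDimensional_algebroidModel
  have hp := contMDiff_proj (IB := 𝓘(ℝ, EM)) (n := ∞) (F := EM)
    (TangentSpace 𝓘(ℝ, EM) : M → Type _)
  refine (contMDiffAt_hom_bundle _).2 ⟨hp v, contMDiffAt_clm_of_apply fun w => ?_⟩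
  have hs : ∀ᶠ u : TangentBundle 𝓘(ℝ, EM) M in nhds v,
      G.unit u.1 ∈ (G.submersionAt_unit v.1).domChart.source :=
    (G.contMDiff_unit.continuous.comp hp.continuous).continuousAt.eventually_mem
      ((G.submersionAt_unit v.1).domChart.open_source.mem_nhds
        (G.submersionAt_unit v.1).mem_domChart_source)
  have hX : ContMDiff 𝓘(ℝ, EM).tangent 𝓘(ℝ, E).tangent ∞ (tangentMap 𝓘(ℝ, EM) 𝓘(ℝ, E) G.unit) :=
    G.contMDiff_unit.contMDiff_tangentMap (by simp)
  have hY := (KernelBundle.contMDiffAt_symm (G.submersionAt_unit v.1) w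
    (G.submersionAt_unit v.1).mem_domChart_source).comp v (G.contMDiff_unit.comp hp v)
  refine ((Ω.contMDiffAt_apply₂ (hX v) hY).neg).congr_of_eventuallyEq ?_
  filter_upwards [hs] with u hu
  have hu' : u.1 ∈ (trivializationAt G.AlgebroidModel G.Algebroid v.1).baseSet := hu
  refine (DFunLike.congr_fun (ContinuousLinearMap.inCoordinates_eq hu' (mem_univ u.1)) w).trans ?_
  change -Ω.toFun (G.unit u.1) (mfderiv 𝓘(ℝ, EM) 𝓘(ℝ, E) G.unit u.1 u.2) (G.algebroidIncl u.1
    ((trivializationAt G.AlgebroidModel G.Algebroid v.1).symm u.1 w)) = _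
  rw [G.trivializationAt_algebroid_symm hu w]
  rfl

end LieGroupoid

/-! ### Multiplicative 2-forms -/

namespace LieGroupoid

variable {E : Type*} [NormedAddCommGroup E] [NormedSpace ℝ E]
  {EM : Type*} [NormedAddCommGroup EM] [NormedSpace ℝ EM]
  {Γ : Type*} [TopologicalSpace Γ] [ChartedSpace E Γ]
  {M : Type*} [TopologicalSpace M] [ChartedSpace EM M]
  (G : LieGroupoid E EM Γ M)

/-- Extensionality for elements of `A^*` whose base points are only propositionally equal: elements
of the two fibres of `A` are compared as tangent vectors of `Γ`. -/
theorem dualAlgebroid_ext {x y : M} (e : x = y) {L : G.Algebroid x →L[ℝ] ℝ}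
    {L' : G.Algebroid y →L[ℝ] ℝ}
    (h : ∀ a a', (⟨_, G.algebroidIncl x a⟩ : TangentBundle 𝓘(ℝ, E) Γ) =
      ⟨_, G.algebroidIncl y a'⟩ → L a = L' a') :
    (⟨x, L⟩ : G.DualAlgebroid) = ⟨y, L'⟩ := by
  subst e
  rw [TotalSpace.mk_inj]
  ext a
  exact h a a rfl

theorem tangentMap_tgt_unit (v : TangentBundle 𝓘(ℝ, EM) M) :
    tangentMap 𝓘(ℝ, E) 𝓘(ℝ, EM) G.tgt (tangentMap 𝓘(ℝ, EM) 𝓘(ℝ, E) G.unit v) = v := by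
  rw [← tangentMap_comp_at v (G.mdifferentiable_tgt _) (G.mdifferentiable_unit _),
    show G.tgt ∘ G.unit = id from funext G.tgt_unit, tangentMap_id]
  rfl

theorem tangentMap_src_unit (v : TangentBundle 𝓘(ℝ, EM) M) :
    tangentMap 𝓘(ℝ, E) 𝓘(ℝ, EM) G.src (tangentMap 𝓘(ℝ, EM) 𝓘(ℝ, E) G.unit v) = v := by
  rw [← tangentMap_comp_at v (G.mdifferentiable_src _) (G.mdifferentiable_unit _),
    show G.src ∘ G.unit = id from funext G.src_unit, tangentMap_id]
  rfl

variable [IsManifold 𝓘(ℝ, E) ∞ Γ] (Ω : TwoForm E Γ)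

/-- The covector `Ω^♭(T1 v)` at a unit has as target the value at `v` of the base map. -/
theorem cotangentTgt_flat_unit (v : TangentBundle 𝓘(ℝ, EM) M) :
    G.cotangentTgt (Ω.flat (tangentMap 𝓘(ℝ, EM) 𝓘(ℝ, E) G.unit v)) =
      G.bundleMap (G.baseFlat Ω) v := by
  refine G.dualAlgebroid_ext (G.tgt_unit v.1) fun a a' haa' => ?_
  have h := (TotalSpace.mk_inj ..).1 ((G.mk_rightTranslate_unit a).trans haa')
  rw [baseFlat_apply, ← h]
  rfl

variable {G Ω} in
/-- If `Ω` is multiplicative, `Ω^♭` maps composable vectors to composable covectors: the value of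
`Ω` on the product of `(X, Y)` with the pair `(g · (ρ a - a), a · h)`, whose product is zero,
vanishes. -/
theorem cotangentSrc_flat_eq_cotangentTgt_flat {g h : Γ}
    (hΩ : ∀ (X₁ X₂ : TangentSpace 𝓘(ℝ, E) g) (Y₁ Y₂ : TangentSpace 𝓘(ℝ, E) h),
        G.TangentComposable X₁ Y₁ → G.TangentComposable X₂ Y₂ →
          Ω.toFun (G.mul g h) (G.tangentMul g h (X₁, Y₁)) (G.tangentMul g h (X₂, Y₂)) =
            Ω.toFun g X₁ X₂ + Ω.toFun h Y₁ Y₂)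
    {X : TangentSpace 𝓘(ℝ, E) g} {Y : TangentSpace 𝓘(ℝ, E) h} (hXY : G.TangentComposable X Y) :
    G.cotangentSrc (Ω.flat ⟨g, X⟩) = G.cotangentTgt (Ω.flat ⟨h, Y⟩) := by
  have hgh : G.src g = G.tgt h := congrArg TotalSpace.proj hXY
  refine G.dualAlgebroid_ext hgh fun a a' haa' => ?_
  obtain ⟨h1, h2⟩ := G.tangentComposable_leftTranslate_rightTranslate hgh a a' haa'
  have h3 := hΩ _ _ _ _ hXY h1
  rw [h2, map_zero, ← neg_sub (G.algebroidIncl _ a), map_neg, map_neg] at h3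
  exact congrArg Neg.neg (neg_add_eq_zero.1 h3.symm)

variable {G Ω} in
/-- If `Ω^♭` preserves products, the base map is determined by restricting to the units: `X` is
composable with the unit at its source, and the unit at its target is composable with `X`. -/
theorem isLieGroupoidMorphism_flat [IsManifold 𝓘(ℝ, EM) ∞ M] [FiniteDimensional ℝ E]
    (hΩ : ∀ X Y Z : TangentBundle 𝓘(ℝ, E) Γ, G.tangentGroupoid.IsProd X Y Z →
      G.cotangentGroupoid.IsProd (Ω.flat X) (Ω.flat Y) (Ω.flat Z)) :
    IsLieGroupoidMorphism 𝓘(ℝ, E).tangent 𝓘(ℝ, EM).tangent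
      (𝓘(ℝ, E).prod 𝓘(ℝ, E →L[ℝ] ℝ)) (𝓘(ℝ, EM).prod 𝓘(ℝ, G.AlgebroidModel →L[ℝ] ℝ))
      G.tangentGroupoid G.cotangentGroupoid Ω.flat (G.bundleMap (G.baseFlat Ω)) := by
  have hc : ∀ X Y : TangentBundle 𝓘(ℝ, E) Γ, G.TangentComposable X.2 Y.2 →
      G.cotangentSrc (Ω.flat X) = G.cotangentTgt (Ω.flat Y) :=
    fun X Y h => (hΩ X Y _ ⟨h, rfl⟩).1
  refine ⟨Ω.contMDiff_flat, G.contMDiff_bundleMap_baseFlat Ω, fun X => ?_, fun X => ?_, hΩ⟩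
  · let v := tangentMap 𝓘(ℝ, E) 𝓘(ℝ, EM) G.src X
    let V := tangentMap 𝓘(ℝ, EM) 𝓘(ℝ, E) G.unit v
    exact (hc X V (G.tangentMap_tgt_unit v).symm).trans (G.cotangentTgt_flat_unit Ω v)
  · let v := tangentMap 𝓘(ℝ, E) 𝓘(ℝ, EM) G.tgt X
    let V := tangentMap 𝓘(ℝ, EM) 𝓘(ℝ, E) G.unit v
    -- The unit `V` is composable with itself, so its image has the same source and target.
    have h1 := hc V X (G.tangentMap_src_unit v)
    have h2 := hc V V ((G.tangentMap_src_unit v).trans (G.tangentMap_tgt_unit v).symm)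
    exact h1.symm.trans (h2.trans (G.cotangentTgt_flat_unit Ω v))

end LieGroupoid

theorem mainTheorem8
    {E : Type*} [NormedAddCommGroup E] [NormedSpace ℝ E] [FiniteDimensional ℝ E]
    {EM : Type*} [NormedAddCommGroup EM] [NormedSpace ℝ EM] [FiniteDimensional ℝ EM]
    {Γ : Type*} [TopologicalSpace Γ] [ChartedSpace E Γ] [IsManifold 𝓘(ℝ, E) ∞ Γ]
    {M : Type*} [TopologicalSpace M] [ChartedSpace EM M] [IsManifold 𝓘(ℝ, EM) ∞ M]
    (G : LieGroupoid E EM Γ M) (Ω : TwoForm E Γ) :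
    [ -- `Ω^♭` is a morphism of Lie groupoids over some vector-bundle morphism `TM → A^*`
      ∃ w : ∀ x : M, TangentSpace 𝓘(ℝ, EM) x →L[ℝ] G.Algebroid x →L[ℝ] ℝ,
        IsLieGroupoidMorphism 𝓘(ℝ, E).tangent 𝓘(ℝ, EM).tangent
          (𝓘(ℝ, E).prod 𝓘(ℝ, E →L[ℝ] ℝ)) (𝓘(ℝ, EM).prod 𝓘(ℝ, G.AlgebroidModel →L[ℝ] ℝ))
          G.tangentGroupoid G.cotangentGroupoid Ω.flat (G.bundleMap w),
      -- `Ω^♭` maps composable pairs to composable pairs and preserves products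
      ∀ X Y Z : TangentBundle 𝓘(ℝ, E) Γ, G.tangentGroupoid.IsProd X Y Z →
        G.cotangentGroupoid.IsProd (Ω.flat X) (Ω.flat Y) (Ω.flat Z),
      -- `Ω` is a morphism of Lie groupoids from `TΓ ⊕ TΓ ⇉ TM ⊕ TM` to the additive group `ℝ`
      IsLieGroupoidMorphism (𝓘(ℝ, E).prod 𝓘(ℝ, E × E)) (𝓘(ℝ, EM).prod 𝓘(ℝ, EM × EM))
        𝓘(ℝ, ℝ) 𝓘(ℝ, PUnit) G.tangentSumGroupoid additiveGroupoid Ω.onSum (fun _ => PUnit.unit),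
      -- `Ω` is additive on products of composable pairs
      ∀ (g h : Γ) (X₁ X₂ : TangentSpace 𝓘(ℝ, E) g) (Y₁ Y₂ : TangentSpace 𝓘(ℝ, E) h),
        G.TangentComposable X₁ Y₁ → G.TangentComposable X₂ Y₂ →
          Ω.toFun (G.mul g h) (G.tangentMul g h (X₁, Y₁)) (G.tangentMul g h (X₂, Y₂)) =
            Ω.toFun g X₁ X₂ + Ω.toFun h Y₁ Y₂ ].TFAE := by
  tfae_have 1 → 2 := fun ⟨_, hw⟩ => hw.isProd
  tfae_have 2 → 1 := fun h => ⟨G.baseFlat Ω, LieGroupoid.isLieGroupoidMorphism_flat h⟩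
  tfae_have 2 → 4 := by
    intro h g k X₁ X₂ Y₁ Y₂ h₁ h₂
    obtain ⟨-, θ, hθ, hadd⟩ := h ⟨g, X₁⟩ ⟨k, Y₁⟩ _ ⟨h₁, rfl⟩
    have hθ' : -Ω.toFun (G.mul g k) (G.tangentMul g k (X₁, Y₁)) = θ :=
      eq_of_heq (TotalSpace.mk.inj hθ).2
    have h' : θ (G.tangentMul g k (X₂, Y₂)) = -Ω.toFun g X₁ X₂ + -Ω.toFun k Y₁ Y₂ :=
      hadd X₂ Y₂ h₂
    rw [← hθ', ← neg_add] at h'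
    exact neg_injective h'
  tfae_have 4 → 2 := by
    rintro h ⟨g, X⟩ ⟨k, Y⟩ _ ⟨hXY, rfl⟩
    refine ⟨LieGroupoid.cotangentSrc_flat_eq_cotangentTgt_flat (h g k) hXY, _, rfl,
      fun X' Y' hXY' => ?_⟩
    exact (congrArg Neg.neg (h g k X X' Y Y' hXY hXY')).trans (neg_add _ _)
  tfae_have 3 → 4 := fun h g k X₁ X₂ Y₁ Y₂ h₁ h₂ =>
    h.isProd ⟨g, (X₁, X₂)⟩ ⟨k, (Y₁, Y₂)⟩ _ ⟨h₁, h₂, rfl⟩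
  tfae_have 4 → 3 := by
    refine fun h => ⟨Ω.contMDiff_onSum, contMDiff_const, fun _ => rfl, fun _ => rfl, ?_⟩
    rintro X Y _ ⟨h₁, h₂, rfl⟩
    exact h _ _ _ _ _ _ h₁ h₂
  tfae_finish
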